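/- Let $\mathbb X\subset\mathbb R^D$ be a Borel set with Lebesgue measure, let $p_\tau:\mathbb X\times\mathbb X\to[0,\infty)$ be a (jointly measurable) transition density, i.e. $\int_{\mathbb X}p_\tau(x,y)\,\mathrm dy=1$ for all $x\in\mathbb X$, and let $\rho_0$ be a probability density on $\mathbb X$. Let $(X_t,X_{t+\tau})$ have joint density $\rho(x,y)=\rho_0(x)p_\tau(x,y)$. Let $s$ be uniform on $[0,1]$ and let $X_t',X_{t+\tau}'$ be standard Gaussian vectors in $\mathbb R^D$, with $s$, $(X_t,X_{t+\tau})$ and the Gaussian vectors independent. Put $X_t^s=(1-s)X_t'+sX_t$ and $X_{t+\tau}^s=(1-s)X_{t+\tau}'+sX_{t+\tau}$. For Borel velocity fields $v_0,v_1:\mathbb R\times\mathbb R^D\times\mathbb X\to\mathbb R^D$ define $$\mathcal L[v_0,v_1]=\mathcal L_0[v_0]+\mathcal L_1[v_1],$$ $$\mathcal L_0[v]=\mathbb E\,\bigl\|v(s,X_{t+\tau}^s,X_t)-(X_{t+\tau}-X_{t+\tau}')\bigr\|^2,\qquad \mathcal L_1[v]=\mathbb E\,\bigl\|v(s,X_t^s,X_{t+\tau})-(X_t-X_t')\bigr\|^2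 ,$$ with values in $[0,\infty]$. Fix a measurable map $r:\mathbb X\to\mathbb R^d$ (the reaction coordinate; for instance a continuously differentiable one), and for Borel $v_0^{\mathrm{RC}},v_1^{\mathrm{RC}}:\mathbb R\times\mathbb R^D\times\mathbb R^d\to\mathbb R^D$ put $$\mathcal L^{\mathrm{FMRC}}[v_0^{\mathrm{RC}},v_1^{\mathrm{RC}},r]=\mathcal L_0\bigl[v_0^{\mathrm{RC}}(\cdot,\ast,r(\#))\bigr]+\mathcal L_1\bigl[v_1^{\mathrm{RC}}(\cdot,\ast,r(\#))\bigr].$$ The system is called lumpable with respect to $r$ if there is a measurable $p_\tau^L:\mathbb R^d\times\mathbb X\to[0,\infty)$ with $p_\tau(x,y)=p_\tau^L(r(x),y)$, and decomposable with respect to $r$ if there are measurable $p_\tau^D:\mathbb X\times\mathbb R^d\to[0,\infty)$ and $p_{\mathrm{local}}:\mathbb R^d\times\mathbb X\to[0,\infty)$ with $p_\tau(x,y)=p_\tau^D(x,r(y))\,p_{\mathrm{local}}(r(y),y)$; both identities between densities are meant for almost every $(x,y)$ with respect to $\rho_0(x)\,\mathrm dx\,\mathrm dy$ (that is, Lebesgue-almost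 everywhere if $\rho_0>0$). Then the minima of $\mathcal L$ and of $\mathcal L^{\mathrm{FMRC}}[\cdot,\cdot,r]$ are attained, and: 1. $\displaystyle\min_{v_0^{\mathrm{RC}},v_1^{\mathrm{RC}}}\mathcal L^{\mathrm{FMRC}}[v_0^{\mathrm{RC}},v_1^{\mathrm{RC}},r]\ \ge\ \min_{v_0,v_1}\mathcal L[v_0,v_1]$. 2. If $\min\mathcal L<\infty$ (for instance if $X_t$ and $X_{t+\tau}$ have finite second moments), equality holds in 1 if and only if the system is both lumpable and decomposable with respect to $r$. -/

import Mathlib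

open MeasureTheory ProbabilityTheory
open scoped NNReal ENNReal

namespace FMRC

/-- Euclidean space `ℝⁿ`. -/
abbrev E (n : ℕ) : Type := EuclideanSpace ℝ (Fin n)

/-- Lebesgue measure on a measurable set `X ⊆ ℝᴰ`, as a measure on the subtype. -/
noncomputable def leb {D : ℕ} (X : Set (E D)) : Measure X :=
  Measure.comap Subtype.val (volume : Measure (E D))

/-- `p` is a transition density on the state space `X ⊆ ℝᴰ` (with Lebesgue measure): for every
starting point `x`, the function `p x` is a probability density on `X`. -/
structure IsTransitionDensity {D : ℕ} {X : Set (E D)} (p : X → X → ℝ≥0) : Prop where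
  measurable : Measurable (fun q : X × X => p q.1 q.2)
  lintegral_eq_one : ∀ x : X, ∫⁻ y, (p x y : ℝ≥0∞) ∂(leb X) = 1

/-- `ρ₀` is a probability density on `X` with respect to Lebesgue measure. -/
structure IsProbDensity {D : ℕ} {X : Set (E D)} (ρ₀ : X → ℝ≥0) : Prop where
  measurable : Measurable ρ₀
  lintegral_eq_one : ∫⁻ x, (ρ₀ x : ℝ≥0∞) ∂(leb X) = 1

/-- The law of the pair `(X_t, X_{t+τ})`, with joint density `ρ(x, y) = ρ₀(x) p_τ(x, y)`. -/
noncomputable def jointLaw {D : ℕ} {X : Set (E D)} (p : X → X → ℝ≥0) (ρ₀ : X → ℝ≥0) :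
    Measure (X × X) :=
  ((leb X).prod (leb X)).withDensity (fun q => (ρ₀ q.1 : ℝ≥0∞) * (p q.1 q.2 : ℝ≥0∞))

/-- The linear interpolation `I(s; a, b) = (1 - s) a + s b`. -/
noncomputable def interp {D : ℕ} (s : ℝ) (a b : E D) : E D := (1 - s) • a + s • b

/-- The forward conditional flow-matching loss: `s` is uniform on `[0, 1]`, the pair
`q = (X_t, X_{t+τ})` has law `ρ`, and `w` is an independent standard Gaussian vector.
The conditioning variable is `X_t`. -/
noncomputable def loss₀ {D : ℕ} {X : Set (E D)} (p : X → X → ℝ≥0) (ρ₀ : X → ℝ≥0)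
    (v : ℝ × E D × X → E D) : ℝ≥0∞ :=
  ∫⁻ s in Set.Icc (0 : ℝ) 1, ∫⁻ q : X × X, ∫⁻ w : E D,
    ‖v (s, interp s w (q.2 : E D), q.1) - ((q.2 : E D) - w)‖ₑ ^ 2
      ∂(stdGaussian (E D)) ∂(jointLaw p ρ₀)

/-- The backward conditional flow-matching loss; the conditioning variable is `X_{t+τ}`. -/
noncomputable def loss₁ {D : ℕ} {X : Set (E D)} (p : X → X → ℝ≥0) (ρ₀ : X → ℝ≥0)
    (v : ℝ × E D × X → E D) : ℝ≥0∞ :=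
  ∫⁻ s in Set.Icc (0 : ℝ) 1, ∫⁻ q : X × X, ∫⁻ w : E D,
    ‖v (s, interp s w (q.1 : E D), q.2) - ((q.1 : E D) - w)‖ₑ ^ 2
      ∂(stdGaussian (E D)) ∂(jointLaw p ρ₀)

/-- The full loss `L[v₀, v₁] = L₀[v₀] + L₁[v₁]`. -/
noncomputable def fullLoss {D : ℕ} {X : Set (E D)} (p : X → X → ℝ≥0) (ρ₀ : X → ℝ≥0)
    (v₀ v₁ : ℝ × E D × X → E D) : ℝ≥0∞ :=
  loss₀ p ρ₀ v₀ + loss₁ p ρ₀ v₁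

/-- The bottlenecked velocity field `v(·, ∗, r(#))`. -/
def bottleneck {D d : ℕ} {X : Set (E D)} (r : X → E d) (v : ℝ × E D × E d → E D) :
    ℝ × E D × X → E D :=
  fun a => v (a.1, a.2.1, r a.2.2)

/-- The FMRC loss `L^FMRC[v₀, v₁, r] = L₀[v₀(·, ∗, r(#))] + L₁[v₁(·, ∗, r(#))]`. -/
noncomputable def fmrcLoss {D d : ℕ} {X : Set (E D)} (p : X → X → ℝ≥0) (ρ₀ : X → ℝ≥0)
    (r : X → E d) (v₀ v₁ : ℝ × E D × E d → E D) : ℝ≥0∞ :=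
  loss₀ p ρ₀ (bottleneck r v₀) + loss₁ p ρ₀ (bottleneck r v₁)

/-- All values of the full loss, over pairs of Borel velocity fields. -/
def fullLossValues {D : ℕ} {X : Set (E D)} (p : X → X → ℝ≥0) (ρ₀ : X → ℝ≥0) : Set ℝ≥0∞ :=
  {l | ∃ v₀ v₁ : ℝ × E D × X → E D, Measurable v₀ ∧ Measurable v₁ ∧ l = fullLoss p ρ₀ v₀ v₁}

/-- All values of the FMRC loss for the fixed reaction coordinate `r`, over pairs of Borel
velocity fields. -/
def fmrcLossValues {D d : ℕ} {X : Set (E D)} (p : X → X → ℝ≥0) (ρ₀ : X → ℝ≥0)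
    (r : X → E d) : Set ℝ≥0∞ :=
  {l | ∃ v₀ v₁ : ℝ × E D × E d → E D,
    Measurable v₀ ∧ Measurable v₁ ∧ l = fmrcLoss p ρ₀ r v₀ v₁}

/-- The measure `ρ₀(x) dx dy` on `X × X`. Identities between transition densities are meant up to
its null sets: for almost every `y` and almost every initial state `x`. If `ρ₀ > 0`, these are
the Lebesgue null sets. -/
noncomputable def refMeasure {D : ℕ} {X : Set (E D)} (ρ₀ : X → ℝ≥0) : Measure (X × X) :=
  ((leb X).withDensity (fun x => (ρ₀ x : ℝ≥0∞))).prod (leb X)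

/-- Lumpability: `p_τ(x, y) = p_L(r(x), y)`. -/
def Lumpable {D d : ℕ} {X : Set (E D)} (p : X → X → ℝ≥0) (ρ₀ : X → ℝ≥0) (r : X → E d) : Prop :=
  ∃ pL : E d × X → ℝ≥0, Measurable pL ∧
    ∀ᵐ q ∂(refMeasure ρ₀), p q.1 q.2 = pL (r q.1, q.2)

/-- Decomposability: `p_τ(x, y) = p_D(x, r(y)) p_local(r(y), y)`. -/
def Decomposable {D d : ℕ} {X : Set (E D)} (p : X → X → ℝ≥0) (ρ₀ : X → ℝ≥0) (r : X → E d) :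
    Prop :=
  ∃ (pD : X × E d → ℝ≥0) (pLocal : E d × X → ℝ≥0), Measurable pD ∧ Measurable pLocal ∧
    ∀ᵐ q ∂(refMeasure ρ₀), p q.1 q.2 = pD (q.1, r q.2) * pLocal (r q.2, q.2)

end FMRC

/-!
The loss of a velocity `v` is an `L²` regression risk: it is minimized by the conditional mean of
the target, and its excess over the minimum is the squared `L²` distance of `v` to that conditional
mean. A bottlenecked velocity sees the conditioning variable `a` only through `r a`, so its loss is
the loss for the law of `(r a, b)` instead of `(a, b)`. Hence the two minima agree if and only if
the optimal velocities of the two problems agree almost everywhere.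

At a time `0 < s < 1` the optimal velocity is an affine function of the mean of the posterior of `b`
given `(1 - s) • w + s • b = z`. The posteriors at different `z` are exponential tilts of one
another, so their means are the derivatives of a cumulant generating function, which determines the
law of `b`. Thus the velocity determines the conditional law of `b` given `a`, and the bottleneck is
lossless if and only if that law factors through `r`. In terms of densities this is lumpability for
the pair `(X_t, X_{t+τ})` and decomposability for the reversed pair.
-/

namespace FMRC

/-! ### Least-squares regression -/

section Regression

open scoped RealInnerProductSpace

variable {V : Type*} [NormedAddCommGroup V] [InnerProductSpace ℝ V]

section BiasVariance

variable [CompleteSpace V] {Ω : Type*} [MeasurableSpace Ω] {η : Measure Ω}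
  [IsProbabilityMeasure η] {f : Ω → V}

lemma integral_norm_sub_sq_eq_add (hf : MemLp f 2 η) (a : V) :
    ∫ ω, ‖a - f ω‖ ^ 2 ∂η = ∫ ω, ‖(∫ ω, f ω ∂η) - f ω‖ ^ 2 ∂η + ‖a - ∫ ω, f ω ∂η‖ ^ 2 := by
  set m := ∫ ω, f ω ∂η with hm
  have hfi : Integrable f η := hf.integrable one_le_two
  have hmi : Integrable (fun ω => m - f ω) η := (integrable_const m).sub hfi
  have hsq : Integrable (fun ω => ‖m - f ω‖ ^ 2) η := ((memLp_const m).sub hf).norm.integrable_sq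
  have hcross : Integrable (fun ω => 2 * ⟪a - m, m - f ω⟫) η :=
    (hmi.const_inner _).const_mul 2
  have hcross_zero : ∫ ω, 2 * ⟪a - m, m - f ω⟫ ∂η = 0 := by
    rw [integral_const_mul, integral_inner hmi, integral_sub (integrable_const m) hfi]
    simp [← hm]
  have hexpand (ω : Ω) : ‖a - f ω‖ ^ 2 = ‖m - f ω‖ ^ 2 + 2 * ⟪a - m, m - f ω⟫ + ‖a - m‖ ^ 2 := by
    rw [← sub_add_sub_cancel' m (f ω) a, norm_add_sq_real, real_inner_comm]
  simp_rw [hexpand]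
  rw [integral_add (f := fun ω => ‖m - f ω‖ ^ 2 + 2 * ⟪a - m, m - f ω⟫)
    (hsq.add hcross) (integrable_const _), integral_add hsq hcross, hcross_zero]
  simp

lemma lintegral_enorm_sub_sq_eq_add (hf : MemLp f 2 η) (a : V) :
    ∫⁻ ω, ‖a - f ω‖ₑ ^ 2 ∂η
      = ∫⁻ ω, ‖(∫ ω, f ω ∂η) - f ω‖ₑ ^ 2 ∂η + ‖a - ∫ ω, f ω ∂η‖ₑ ^ 2 := by
  have hconv (b : V) : ∫⁻ ω, ‖b - f ω‖ₑ ^ 2 ∂η = ENNReal.ofReal (∫ ω, ‖b - f ω‖ ^ 2 ∂η) := by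
    have hsq : Integrable (fun ω => ‖b - f ω‖ ^ 2) η := ((memLp_const b).sub hf).norm.integrable_sq
    rw [ofReal_integral_eq_lintegral_ofReal hsq (ae_of_all _ fun ω => by positivity)]
    simp_rw [ENNReal.ofReal_pow (norm_nonneg _), ofReal_norm]
  rw [hconv, hconv, integral_norm_sub_sq_eq_add hf a,
    ENNReal.ofReal_add (integral_nonneg fun ω => by positivity) (by positivity),
    ENNReal.ofReal_pow (norm_nonneg _), ofReal_norm]

end BiasVariance

variable {X Y : Type*} [MeasurableSpace X] [MeasurableSpace Y]

/-- The mean-square error of the predictor `v`, which sees only the first component of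
`q ∼ Θ`, for the target `T q`. -/
noncomputable def regressionLoss (Θ : Measure (X × Y)) (T : X × Y → V) (v : X → V) : ℝ≥0∞ :=
  ∫⁻ q, ‖v q.1 - T q‖ₑ ^ 2 ∂Θ

/-- The conditional mean of the target `T` under the disintegration kernel `K`. -/
noncomputable def regressionMean (K : Kernel X Y) (T : X × Y → V) (x : X) : V :=
  ∫ y, T (x, y) ∂(K x)

variable [MeasurableSpace V] [BorelSpace V] [SecondCountableTopology V]
  {θ : Measure X} [SFinite θ] {K : Kernel X Y} [IsMarkovKernel K] {T : X × Y → V} {v : X → V}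

lemma measurable_regressionMean (hT : Measurable T) : Measurable (regressionMean K T) :=
  hT.stronglyMeasurable.integral_kernel_prod_right'.measurable

variable [CompleteSpace V]

lemma regressionLoss_compProd_eq_add (hT : Measurable T)
    (hT2 : ∀ᵐ x ∂θ, MemLp (fun y => T (x, y)) 2 (K x)) (hv : Measurable v) :
    regressionLoss (θ ⊗ₘ K) T v
      = regressionLoss (θ ⊗ₘ K) T (regressionMean K T)
        + ∫⁻ x, ‖v x - regressionMean K T x‖ₑ ^ 2 ∂θ := by
  have hm := measurable_regressionMean (K := K) hT
  unfold regressionLoss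
  rw [Measure.lintegral_compProd (by fun_prop), Measure.lintegral_compProd (by fun_prop),
    ← lintegral_add_right _ (by fun_prop)]
  refine lintegral_congr_ae ?_
  filter_upwards [hT2] with x hx using lintegral_enorm_sub_sq_eq_add hx (v x)

lemma regressionLoss_regressionMean_le (hT : Measurable T)
    (hT2 : ∀ᵐ x ∂θ, MemLp (fun y => T (x, y)) 2 (K x)) (hv : Measurable v) :
    regressionLoss (θ ⊗ₘ K) T (regressionMean K T) ≤ regressionLoss (θ ⊗ₘ K) T v := by
  rw [regressionLoss_compProd_eq_add hT hT2 hv]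
  exact le_self_add

lemma regressionLoss_eq_iff_ae_eq_regressionMean (hT : Measurable T)
    (hT2 : ∀ᵐ x ∂θ, MemLp (fun y => T (x, y)) 2 (K x)) (hv : Measurable v)
    (hfin : regressionLoss (θ ⊗ₘ K) T (regressionMean K T) < ∞) :
    regressionLoss (θ ⊗ₘ K) T v = regressionLoss (θ ⊗ₘ K) T (regressionMean K T)
      ↔ v =ᵐ[θ] regressionMean K T := by
  have hm := measurable_regressionMean (K := K) hT
  have hcancel := ENNReal.add_right_inj (b := ∫⁻ x, ‖v x - regressionMean K T x‖ₑ ^ 2 ∂θ)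
    (c := 0) hfin.ne
  rw [add_zero] at hcancel
  rw [regressionLoss_compProd_eq_add hT hT2 hv, hcancel, lintegral_eq_zero_iff (by fun_prop)]
  simp [Filter.EventuallyEq, sub_eq_zero]

end Regression

/-! ### Exponential tilts of kernels -/

section TiltedKernel

variable {X Y : Type*} [MeasurableSpace X] [MeasurableSpace Y]

/-- The kernel `x ↦ (κ x).tilted (h (x, ·))`. By Bayes' rule it is the conditional law of `y` given
`x` when `(x, y)` has a joint density proportional to `exp h` with respect to `μ ⊗ₘ κ`. -/
noncomputable def tiltedKernel (κ : Kernel X Y) [IsSFiniteKernel κ] (h : X × Y → ℝ) :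
    Kernel X Y :=
  κ.withDensity fun x y => ENNReal.ofReal (Real.exp (h (x, y)) / ∫ y, Real.exp (h (x, y)) ∂(κ x))

variable {κ : Kernel X Y} {h : X × Y → ℝ}

lemma measurable_integral_exp [IsSFiniteKernel κ] (hh : Measurable h) :
    Measurable fun x => ∫ y, Real.exp (h (x, y)) ∂(κ x) :=
  hh.exp.stronglyMeasurable.integral_kernel_prod_right'.measurable

lemma tiltedKernel_apply [IsSFiniteKernel κ] (hh : Measurable h) (x : X) :
    tiltedKernel κ h x = (κ x).tilted fun y => h (x, y) := by
  have hZ := measurable_integral_exp (κ := κ) hh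
  exact Kernel.withDensity_apply _ (hh.exp.div (hZ.comp measurable_fst)).ennreal_ofReal x

lemma isMarkovKernel_tiltedKernel [IsMarkovKernel κ] (hh : Measurable h)
    (hint : ∀ x, Integrable (fun y => Real.exp (h (x, y))) (κ x)) :
    IsMarkovKernel (tiltedKernel κ h) where
  isProbabilityMeasure x := by
    rw [tiltedKernel_apply hh]
    exact isProbabilityMeasure_tilted (hint x)

lemma withDensity_exp_compProd [IsMarkovKernel κ] (μ : Measure X) [SFinite μ] (hh : Measurable h)
    (hint : ∀ x, Integrable (fun y => Real.exp (h (x, y))) (κ x)) :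
    (μ ⊗ₘ κ).withDensity (fun q => ENNReal.ofReal (Real.exp (h q)))
      = μ.withDensity (fun x => ENNReal.ofReal (∫ y, Real.exp (h (x, y)) ∂(κ x)))
        ⊗ₘ tiltedKernel κ h := by
  have hZ := measurable_integral_exp (κ := κ) hh
  have := isMarkovKernel_tiltedKernel hh hint
  refine Measure.ext_of_lintegral _ fun f hf => ?_
  rw [lintegral_withDensity_eq_lintegral_mul _ (by fun_prop) hf,
    Measure.lintegral_compProd (by fun_prop), Measure.lintegral_compProd hf,
    lintegral_withDensity_eq_lintegral_mul _ (by fun_prop) hf.lintegral_kernel_prod_right']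
  refine lintegral_congr fun x => ?_
  have hpos : 0 < ∫ y, Real.exp (h (x, y)) ∂(κ x) := integral_exp_pos (hint x)
  rw [Pi.mul_apply, tiltedKernel_apply hh, lintegral_tilted, ← lintegral_const_mul _ (by fun_prop)]
  refine lintegral_congr fun y => ?_
  rw [Pi.mul_apply, ← mul_assoc, ← ENNReal.ofReal_mul hpos.le, mul_div_cancel₀ _ hpos.ne']

end TiltedKernel

/-! ### Means of exponential tilts -/

section TiltedMeans

variable {Ω Ω' : Type*} [MeasurableSpace Ω] [MeasurableSpace Ω'] {μ : Measure Ω} {ν : Measure Ω'}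
  [IsProbabilityMeasure μ] [IsProbabilityMeasure ν] {X : Ω → ℝ} {Y : Ω' → ℝ}

lemma cgf_eq_of_integral_tilted_eq (hX : integrableExpSet X μ = Set.univ)
    (hY : integrableExpSet Y ν = Set.univ)
    (h : ∀ t, ∫ ω, X ω ∂(μ.tilted (t * X ·)) = ∫ ω, Y ω ∂(ν.tilted (t * Y ·))) :
    cgf X μ = cgf Y ν := by
  have hdX : Differentiable ℝ (cgf X μ) := fun t =>
    (analyticAt_cgf (by simp [hX])).differentiableAt
  have hdY : Differentiable ℝ (cgf Y ν) := fun t =>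
    (analyticAt_cgf (by simp [hY])).differentiableAt
  refine eq_of_fderiv_eq (𝕜 := ℝ) hdX hdY (fun t => ?_) 0 (by simp)
  have hderiv : deriv (cgf X μ) t = deriv (cgf Y ν) t := by
    rw [← integral_tilted_mul_self (by simp [hX]), ← integral_tilted_mul_self (by simp [hY]), h]
  simp only [← toSpanSingleton_deriv, hderiv]

lemma map_eq_of_integral_tilted_eq (hXm : AEMeasurable X μ) (hYm : AEMeasurable Y ν)
    (hX : integrableExpSet X μ = Set.univ) (hY : integrableExpSet Y ν = Set.univ)
    (h : ∀ t, ∫ ω, X ω ∂(μ.tilted (t * X ·)) = ∫ ω, Y ω ∂(ν.tilted (t * Y ·))) :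
    μ.map X = ν.map Y := by
  have hmgf : mgf X μ = mgf Y ν := by
    ext t
    have htX : t ∈ integrableExpSet X μ := hX ▸ Set.mem_univ t
    have htY : t ∈ integrableExpSet Y ν := hY ▸ Set.mem_univ t
    rw [← exp_cgf htX, ← exp_cgf htY, cgf_eq_of_integral_tilted_eq hX hY h]
  refine Measure.ext_of_complexMGF_eq hXm hYm (funext fun z => ?_)
  exact eqOn_complexMGF_of_mgf hmgf (by simp [hX])

end TiltedMeans

section TiltedMeansInner

open scoped RealInnerProductSpace

variable {V : Type*} [NormedAddCommGroup V] [InnerProductSpace ℝ V] [CompleteSpace V]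
  [SecondCountableTopology V] [MeasurableSpace V] [BorelSpace V]

lemma eq_of_map_inner_eq {μ ν : Measure V} [IsFiniteMeasure μ] [IsFiniteMeasure ν]
    (h : ∀ z : V, μ.map (fun y => ⟪z, y⟫) = ν.map (fun y => ⟪z, y⟫)) : μ = ν := by
  refine Measure.ext_of_charFun (funext fun z => ?_)
  rw [charFun_eq_charFunDual_toDualMap, charFun_eq_charFunDual_toDualMap,
    charFunDual_eq_charFun_map_one, charFunDual_eq_charFun_map_one]
  exact congrArg (charFun · 1) (h z)

theorem eq_of_integral_inner_tilted_eq {μ ν : Measure V} [IsProbabilityMeasure μ]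
    [IsProbabilityMeasure ν]
    (hμ : ∀ z : V, Integrable (fun y => Real.exp ⟪z, y⟫) μ)
    (hν : ∀ z : V, Integrable (fun y => Real.exp ⟪z, y⟫) ν)
    (h : ∀ x z : V, ∫ y, ⟪x, y⟫ ∂(μ.tilted fun y => ⟪z, y⟫)
      = ∫ y, ⟪x, y⟫ ∂(ν.tilted fun y => ⟪z, y⟫)) :
    μ = ν := by
  refine eq_of_map_inner_eq fun z => map_eq_of_integral_tilted_eq (by fun_prop) (by fun_prop)
    (Set.eq_univ_of_forall fun t => ?_) (Set.eq_univ_of_forall fun t => ?_) fun t => ?_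
  · simpa [integrableExpSet, real_inner_smul_left] using hμ (t • z)
  · simpa [integrableExpSet, real_inner_smul_left] using hν (t • z)
  · simpa only [real_inner_smul_left] using h z (t • z)

end TiltedMeansInner

/-! ### Posterior laws in the Gaussian channel -/

section Posterior

open scoped RealInnerProductSpace

variable {V : Type*} [NormedAddCommGroup V] [InnerProductSpace ℝ V]

/-- Up to an additive constant, the logarithm of the conditional density at `z` of
`(1 - s) • w + s • y` given `y`, where `w` is a standard Gaussian vector. -/
noncomputable def logWeight (s : ℝ) (z y : V) : ℝ := -(‖(1 - s)⁻¹ • (z - s • y)‖ ^ 2 / 2)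

lemma exp_logWeight_le_one (s : ℝ) (z y : V) : Real.exp (logWeight s z y) ≤ 1 :=
  Real.exp_le_one_iff.2 (neg_nonpos.2 (by positivity))

@[fun_prop]
lemma continuous_logWeight (s : ℝ) : Continuous fun q : V × V => logWeight s q.1 q.2 := by
  unfold logWeight
  fun_prop

lemma logWeight_eq_add (s : ℝ) (z y : V) :
    logWeight s z y = logWeight s 0 y + ⟪(((1 - s)⁻¹) ^ 2 * s) • z, y⟫
      + -(((1 - s)⁻¹) ^ 2 * ‖z‖ ^ 2 / 2) := by
  unfold logWeight
  simp only [norm_smul, mul_pow, zero_sub, norm_neg, norm_sub_sq_real, inner_smul_right,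
    real_inner_smul_left, Real.norm_eq_abs, sq_abs]
  ring

lemma exp_logWeight_mul_sq_le {s : ℝ} (hs : s ∈ Set.Ioo 0 1) (z y : V) :
    Real.exp (logWeight s z y) * ‖y‖ ^ 2 ≤ s⁻¹ ^ 2 * (2 * ‖z‖ ^ 2 + 4) := by
  obtain ⟨hs0, hs1⟩ := hs
  set u := (1 - s)⁻¹ • (z - s • y) with hu
  have hy : y = s⁻¹ • (z - (1 - s) • u) := by
    rw [hu, smul_inv_smul₀ (sub_pos.2 hs1).ne', sub_sub_cancel, inv_smul_smul₀ hs0.ne']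
  have hnorm : ‖y‖ ≤ s⁻¹ * (‖z‖ + ‖u‖) := by
    rw [hy, norm_smul, Real.norm_of_nonneg (inv_pos.2 hs0).le]
    gcongr
    refine (norm_sub_le _ _).trans ?_
    gcongr
    rw [norm_smul, Real.norm_of_nonneg (by linarith)]
    exact mul_le_of_le_one_left (norm_nonneg u) (by linarith)
  have hsq : ‖y‖ ^ 2 ≤ s⁻¹ ^ 2 * (2 * (‖z‖ ^ 2 + ‖u‖ ^ 2)) := by
    grw [hnorm, mul_pow, add_sq_le]
  have hexp : Real.exp (logWeight s z y) * ‖u‖ ^ 2 ≤ 2 := by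
    rw [logWeight, ← hu, Real.exp_neg, inv_mul_le_iff₀ (Real.exp_pos _)]
    linarith [Real.add_one_le_exp (‖u‖ ^ 2 / 2)]
  calc Real.exp (logWeight s z y) * ‖y‖ ^ 2
      ≤ Real.exp (logWeight s z y) * (s⁻¹ ^ 2 * (2 * (‖z‖ ^ 2 + ‖u‖ ^ 2))) := by gcongr
    _ = s⁻¹ ^ 2 * (2 * (Real.exp (logWeight s z y) * ‖z‖ ^ 2
          + Real.exp (logWeight s z y) * ‖u‖ ^ 2)) := by ring
    _ ≤ s⁻¹ ^ 2 * (2 * (1 * ‖z‖ ^ 2 + 2)) := by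
        gcongr
        exact exp_logWeight_le_one s z y
    _ = s⁻¹ ^ 2 * (2 * ‖z‖ ^ 2 + 4) := by ring

lemma norm_exp_logWeight_smul_le {s : ℝ} (hs : s ∈ Set.Ioo 0 1) (z y : V) :
    ‖Real.exp (logWeight s z y) • y‖ ≤ 1 + s⁻¹ ^ 2 * (2 * ‖z‖ ^ 2 + 4) := by
  rw [norm_smul, Real.norm_of_nonneg (Real.exp_pos _).le]
  have hy : ‖y‖ ≤ 1 + ‖y‖ ^ 2 := by nlinarith [sq_nonneg (‖y‖ - 1)]
  calc Real.exp (logWeight s z y) * ‖y‖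
      ≤ Real.exp (logWeight s z y) * (1 + ‖y‖ ^ 2) := by gcongr
    _ = Real.exp (logWeight s z y) + Real.exp (logWeight s z y) * ‖y‖ ^ 2 := by ring
    _ ≤ 1 + s⁻¹ ^ 2 * (2 * ‖z‖ ^ 2 + 4) :=
        add_le_add (exp_logWeight_le_one s z y) (exp_logWeight_mul_sq_le hs z y)

variable [MeasurableSpace V]

/-- The conditional law of `y ∼ μ` given `(1 - s) • w + s • y = z`, where `w` is an independent
standard Gaussian vector. -/
noncomputable def posterior (μ : Measure V) (s : ℝ) (z : V) : Measure V :=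
  μ.tilted (logWeight s z)

lemma integral_id_posterior (μ : Measure V) (s : ℝ) (z : V) :
    ∫ y, y ∂(posterior μ s z)
      = (∫ y, Real.exp (logWeight s z y) ∂μ)⁻¹ • ∫ y, Real.exp (logWeight s z y) • y ∂μ := by
  simp_rw [posterior, integral_tilted, ← integral_smul, smul_smul, div_eq_inv_mul]

variable [BorelSpace V] (μ : Measure V)

lemma integrable_exp_logWeight [IsFiniteMeasure μ] (s : ℝ) (z : V) :
    Integrable (fun y => Real.exp (logWeight s z y)) μ := by
  refine Integrable.of_bound (by fun_prop) 1 (ae_of_all _ fun y => ?_)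
  rw [Real.norm_of_nonneg (Real.exp_pos _).le]
  exact exp_logWeight_le_one s z y

lemma isProbabilityMeasure_posterior [IsFiniteMeasure μ] [NeZero μ] (s : ℝ) (z : V) :
    IsProbabilityMeasure (posterior μ s z) :=
  isProbabilityMeasure_tilted (integrable_exp_logWeight μ s z)

lemma posterior_eq_tilted_inner [IsProbabilityMeasure μ] (s : ℝ) (z : V) :
    posterior μ s z
      = (posterior μ s 0).tilted fun y => ⟪(((1 - s)⁻¹) ^ 2 * s) • z, y⟫ := by
  set k := -(((1 - s)⁻¹) ^ 2 * ‖z‖ ^ 2 / 2)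
  have hsum : (logWeight s 0 + fun y : V => ⟪(((1 - s)⁻¹) ^ 2 * s) • z, y⟫)
      = logWeight s z + fun _ => -k := by
    ext y
    simp [logWeight_eq_add s z y, k]
  have := isProbabilityMeasure_posterior μ s z
  rw [posterior, posterior, tilted_tilted (integrable_exp_logWeight μ s 0), hsum,
    ← tilted_tilted (integrable_exp_logWeight μ s z), ← posterior, tilted_const]

lemma continuous_integral_exp_logWeight [IsFiniteMeasure μ] (s : ℝ) :
    Continuous fun z => ∫ y, Real.exp (logWeight s z y) ∂μ := by
  refine continuous_of_dominated (bound := fun _ => 1)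
    (fun z => (integrable_exp_logWeight μ s z).aestronglyMeasurable)
    (fun z => ae_of_all _ fun y => ?_) (integrable_const _) (ae_of_all _ fun y => by fun_prop)
  rw [Real.norm_of_nonneg (Real.exp_pos _).le]
  exact exp_logWeight_le_one s z y

variable [SecondCountableTopology V]

lemma memLp_two_id_posterior [IsFiniteMeasure μ] {s : ℝ} (hs : s ∈ Set.Ioo 0 1) (z : V) :
    MemLp (fun y => y) 2 (posterior μ s z) := by
  rw [memLp_two_iff_integrable_sq_norm (by fun_prop), posterior,
    integrable_tilted_iff (integrable_exp_logWeight μ s z)]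
  refine Integrable.of_bound (by fun_prop) (s⁻¹ ^ 2 * (2 * ‖z‖ ^ 2 + 4)) (ae_of_all _ fun y => ?_)
  rw [Real.norm_of_nonneg (by positivity)]
  exact exp_logWeight_mul_sq_le hs z y

lemma continuous_integral_exp_logWeight_smul [IsFiniteMeasure μ] {s : ℝ} (hs : s ∈ Set.Ioo 0 1) :
    Continuous fun z => ∫ y, Real.exp (logWeight s z y) • y ∂μ := by
  refine continuous_iff_continuousAt.2 fun z₀ => continuousAt_of_dominated
    (bound := fun _ => 1 + s⁻¹ ^ 2 * (2 * (‖z₀‖ + 1) ^ 2 + 4))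
    (Filter.Eventually.of_forall fun z => by fun_prop) ?_ (integrable_const _)
    (ae_of_all _ fun y => Continuous.continuousAt (by fun_prop))
  filter_upwards [Metric.ball_mem_nhds z₀ one_pos] with z hz
  refine ae_of_all _ fun y => (norm_exp_logWeight_smul_le hs z y).trans ?_
  have hnorm : ‖z‖ ≤ ‖z₀‖ + 1 :=
    (norm_le_norm_add_norm_sub' z z₀).trans (by grw [mem_ball_iff_norm.1 hz])
  gcongr

lemma continuous_integral_id_posterior [IsFiniteMeasure μ] [NeZero μ] {s : ℝ}
    (hs : s ∈ Set.Ioo 0 1) : Continuous fun z => ∫ y, y ∂(posterior μ s z) := by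
  simp_rw [integral_id_posterior]
  exact ((continuous_integral_exp_logWeight μ s).inv₀ fun z =>
    (integral_exp_pos (integrable_exp_logWeight μ s z)).ne').smul
      (continuous_integral_exp_logWeight_smul μ hs)

/-- The posteriors of one channel at varying `z` are exponential tilts of each other, and the means
of all exponential tilts determine a law. -/
theorem eq_of_integral_id_posterior_ae_eq [FiniteDimensional ℝ V] {μ ν : Measure V}
    [IsProbabilityMeasure μ] [IsProbabilityMeasure ν] {s : ℝ} (hs : s ∈ Set.Ioo 0 1)
    (h : (fun z => ∫ y, y ∂(posterior μ s z)) =ᵐ[volume] fun z => ∫ y, y ∂(posterior ν s z)) :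
    μ = ν := by
  have hmean := funext_iff.1 <| (continuous_integral_id_posterior μ hs).ae_eq_iff_eq volume
    (continuous_integral_id_posterior ν hs) |>.1 h
  set c := ((1 - s)⁻¹) ^ 2 * s with hc
  have hc0 : c ≠ 0 := mul_ne_zero (by simpa using (sub_pos.2 hs.2).ne') hs.1.ne'
  have htilt (η : Measure V) [IsProbabilityMeasure η] (z : V) :
      (posterior η s 0).tilted (fun y => ⟪z, y⟫) = posterior η s (c⁻¹ • z) := by
    rw [posterior_eq_tilted_inner η s (c⁻¹ • z), ← hc, smul_inv_smul₀ hc0]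
  have hexp (η : Measure V) [IsProbabilityMeasure η] (z : V) :
      Integrable (fun y => Real.exp ⟪z, y⟫) (posterior η s 0) := by
    have := isProbabilityMeasure_posterior η s (c⁻¹ • z)
    by_contra hcon
    exact IsProbabilityMeasure.ne_zero (posterior η s (c⁻¹ • z))
      (htilt η z ▸ tilted_of_not_integrable hcon)
  have := isProbabilityMeasure_posterior μ s 0
  have := isProbabilityMeasure_posterior ν s 0
  have hpost : posterior μ s 0 = posterior ν s 0 := by
    refine eq_of_integral_inner_tilted_eq (hexp μ) (hexp ν) fun x z => ?_
    have hint (η : Measure V) [IsProbabilityMeasure η] :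
        Integrable (fun y => y) (posterior η s (c⁻¹ • z)) :=
      have := isProbabilityMeasure_posterior η s (c⁻¹ • z)
      (memLp_two_id_posterior η hs _).integrable one_le_two
    rw [htilt, htilt, integral_inner (hint μ), integral_inner (hint ν), hmean]
  rw [← tilted_neg_same (integrable_exp_logWeight μ s 0),
    ← tilted_neg_same (integrable_exp_logWeight ν s 0)]
  exact congrArg (Measure.tilted · _) hpost

end Posterior

section GaussianChannel

open scoped RealInnerProductSpace
open Module (finrank)

variable {V : Type*} [NormedAddCommGroup V] [InnerProductSpace ℝ V]

variable (V) in
/-- The normalising constant for which `channelConst V s * exp (logWeight s z y)` is the conditional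
density at `z` of `(1 - s) • w + s • y` given `y`. -/
noncomputable def channelConst (s : ℝ) : ℝ :=
  |((1 - s) ^ finrank ℝ V)⁻¹| * ((2 * Real.pi) ^ (finrank ℝ V / 2 : ℝ))⁻¹

lemma channelConst_pos {s : ℝ} (hs : s ≠ 1) : 0 < channelConst V s := by
  have : 1 - s ≠ 0 := sub_ne_zero.2 hs.symm
  unfold channelConst
  positivity

@[fun_prop]
lemma measurable_channelConst : Measurable (channelConst V) := by
  unfold channelConst
  fun_prop

variable [FiniteDimensional ℝ V] [MeasurableSpace V] [BorelSpace V]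

lemma integral_exp_neg_norm_sq_div_two_add (t : V) :
    ∫ w : V, Complex.exp (-((1 / 2 : ℝ) : ℂ) * ‖w‖ ^ 2 + Complex.I * ⟪t, w⟫)
      = ((2 * Real.pi) ^ (finrank ℝ V / 2 : ℝ) : ℝ) * Complex.exp (-‖t‖ ^ 2 / 2) := by
  rw [GaussianFourier.integral_cexp_neg_mul_sq_norm_add (by norm_num),
    Complex.ofReal_cpow (by positivity), Complex.I_sq]
  push_cast
  congr 2 <;> ring

theorem stdGaussian_eq_withDensity : stdGaussian V
    = (volume : Measure V).withDensity fun w =>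
        ENNReal.ofReal (((2 * Real.pi) ^ (finrank ℝ V / 2 : ℝ))⁻¹ * Real.exp (-(‖w‖ ^ 2 / 2))) := by
  set J : ℝ := (2 * Real.pi) ^ (finrank ℝ V / 2 : ℝ)
  have hJ : 0 < J := by positivity
  have hint : Integrable (fun w : V => Real.exp (-(‖w‖ ^ 2 / 2))) := by
    refine (GaussianFourier.integrable_cexp_neg_mul_sq_norm_add
      (V := V) (b := ((1 / 2 : ℝ) : ℂ)) (by norm_num) 0 0).norm.congr (ae_of_all _ fun w => ?_)
    simp only [Complex.norm_exp, zero_mul, add_zero]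
    norm_cast
    ring_nf
  have : IsFiniteMeasure ((volume : Measure V).withDensity
      fun w => ENNReal.ofReal (J⁻¹ * Real.exp (-(‖w‖ ^ 2 / 2)))) :=
    isFiniteMeasure_withDensity_ofReal (hint.const_mul _).2
  refine Measure.ext_of_charFun (funext fun t => ?_)
  rw [charFun_stdGaussian, charFun_apply, integral_withDensity_eq_integral_toReal_smul
    (by fun_prop) (by simp)]
  have hintegrand (w : V) : (ENNReal.ofReal (J⁻¹ * Real.exp (-(‖w‖ ^ 2 / 2)))).toReal •
      Complex.exp (⟪w, t⟫ * Complex.I)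
      = (J : ℂ)⁻¹ * Complex.exp (-((1 / 2 : ℝ) : ℂ) * ‖w‖ ^ 2 + Complex.I * ⟪t, w⟫) := by
    rw [ENNReal.toReal_ofReal (by positivity), Complex.exp_add, real_inner_comm, Complex.real_smul]
    push_cast
    ring_nf
  simp_rw [hintegrand]
  rw [integral_const_mul, integral_exp_neg_norm_sq_div_two_add,
    inv_mul_cancel_left₀ (by exact_mod_cast hJ.ne')]

theorem map_interp_stdGaussian {s : ℝ} (hs : s ≠ 1) (y : V) :
    (stdGaussian V).map (fun w => (1 - s) • w + s • y)
      = volume.withDensity fun z =>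
          ENNReal.ofReal (channelConst V s * Real.exp (logWeight s z y)) := by
  have hs' : 1 - s ≠ 0 := sub_ne_zero.2 hs.symm
  refine Measure.ext_of_lintegral _ fun F hF => ?_
  rw [lintegral_map hF (by fun_prop), stdGaussian_eq_withDensity,
    lintegral_withDensity_eq_lintegral_mul _ (by fun_prop) (by fun_prop),
    lintegral_withDensity_eq_lintegral_mul _ (by fun_prop) hF]
  set J : ℝ := (2 * Real.pi) ^ (finrank ℝ V / 2 : ℝ)
  set H : V → ℝ≥0∞ := fun z => ENNReal.ofReal (J⁻¹ * Real.exp (logWeight s z y)) * F z with hH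
  have hHm : Measurable H := by fun_prop
  have hintegrand (w : V) : ENNReal.ofReal (J⁻¹ * Real.exp (-(‖w‖ ^ 2 / 2)))
      * F ((1 - s) • w + s • y) = H ((1 - s) • w + s • y) := by
    simp only [hH, logWeight, add_sub_cancel_right, inv_smul_smul₀ hs']
  simp only [Pi.mul_apply, hintegrand]
  calc ∫⁻ w, H ((1 - s) • w + s • y)
      = ∫⁻ z, H (z + s • y) ∂(volume.map fun w : V => (1 - s) • w) := by
        rw [lintegral_map (by fun_prop) (by fun_prop)]
    _ = ENNReal.ofReal |((1 - s) ^ finrank ℝ V)⁻¹| * ∫⁻ z, H (z + s • y) := by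
        rw [Measure.map_addHaar_smul _ hs', lintegral_smul_measure, smul_eq_mul]
    _ = ENNReal.ofReal |((1 - s) ^ finrank ℝ V)⁻¹| * ∫⁻ z, H z := by
        rw [lintegral_add_right_eq_self]
    _ = ∫⁻ z, ENNReal.ofReal (channelConst V s * Real.exp (logWeight s z y)) * F z := by
        simp_rw [← lintegral_const_mul _ hHm, hH, ← mul_assoc, ← ENNReal.ofReal_mul (abs_nonneg _),
          ← mul_assoc, channelConst, J]

lemma lintegral_interp_stdGaussian {s : ℝ} (hs : s ≠ 1) (b : V) {f : V → ℝ≥0∞}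
    (hf : Measurable f) :
    ∫⁻ w, f ((1 - s) • w + s • b) ∂(stdGaussian V)
      = ∫⁻ z, ENNReal.ofReal (channelConst V s * Real.exp (logWeight s z b)) * f z := by
  rw [← lintegral_map hf (by fun_prop), map_interp_stdGaussian hs,
    lintegral_withDensity_eq_lintegral_mul _ (by fun_prop) hf]
  rfl

end GaussianChannel

/-! ### Flow matching -/

section FlowMatching

variable {A V : Type*} [NormedAddCommGroup V] [InnerProductSpace ℝ V]

/-- The velocity `b - w`, recovered from `((s, z, a), b)` with `z = (1 - s) • w + s • b`. -/
noncomputable def flowTarget (q : (ℝ × V × A) × V) : V := (1 - q.1.1)⁻¹ • (q.2 - q.1.2.1)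

lemma flowTarget_interp {s : ℝ} (hs : s ≠ 1) (w b : V) (a : A) :
    flowTarget ((s, (1 - s) • w + s • b, a), b) = b - w := by
  rw [flowTarget, inv_smul_eq_iff₀ (sub_ne_zero.2 hs.symm)]
  module

variable [MeasurableSpace A] [MeasurableSpace V]

/-- `κ` as a kernel that sees, and ignores, the time and the interpolated point. -/
noncomputable abbrev liftKernel (κ : Kernel A V) : Kernel (ℝ × V × A) V :=
  κ.comap (fun x => x.2.2) (by fun_prop)

variable [BorelSpace V]

lemma integrable_exp_logWeight_liftKernel {κ : Kernel A V} [IsMarkovKernel κ]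
    (x : ℝ × V × A) :
    Integrable (fun y => Real.exp (logWeight x.1 x.2.1 y)) (liftKernel κ x) :=
  integrable_exp_logWeight (κ x.2.2) x.1 x.2.1

variable [FiniteDimensional ℝ V]

@[fun_prop]
lemma measurable_flowTarget : Measurable (flowTarget : (ℝ × V × A) × V → V) := by
  unfold flowTarget
  fun_prop

/-- The law of the time `s`, uniform on `[0, 1]`. -/
noncomputable abbrev timeLaw : Measure ℝ := volume.restrict (Set.Icc 0 1)

lemma ae_timeLaw_mem_Ioo : ∀ᵐ s ∂timeLaw, s ∈ Set.Ioo (0 : ℝ) 1 := by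
  rw [timeLaw, ← restrict_Ioo_eq_restrict_Icc]
  exact ae_restrict_mem measurableSet_Ioo

/-- The law of `((s, (1 - s) • w + s • b, a), b)` for independent uniform `s`, standard Gaussian `w`
and `(a, b) ∼ ρ`: the time, the interpolated point and the condition are what a velocity field
sees. -/
noncomputable def flowLaw (ρ : Measure (A × V)) : Measure ((ℝ × V × A) × V) :=
  (timeLaw.prod (ρ.prod (stdGaussian V))).map fun x =>
    ((x.1, (1 - x.1) • x.2.2 + x.1 • x.2.1.2, x.2.1.1), x.2.1.2)

/-- The conditional flow-matching loss of `v` for the target `b` and the condition `a`, where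
`(a, b) ∼ ρ`. -/
noncomputable def flowLoss (ρ : Measure (A × V)) (v : ℝ × V × A → V) : ℝ≥0∞ :=
  regressionLoss (flowLaw ρ) flowTarget v

section PushForward

variable {ρ : Measure (A × V)} [SFinite ρ]

lemma lintegral_flowLaw {F : (ℝ × V × A) × V → ℝ≥0∞} (hF : Measurable F) :
    ∫⁻ x, F x ∂(flowLaw ρ)
      = ∫⁻ s in Set.Icc (0 : ℝ) 1, ∫⁻ q, ∫⁻ w,
          F ((s, (1 - s) • w + s • q.2, q.1), q.2) ∂(stdGaussian V) ∂ρ := by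
  rw [flowLaw, lintegral_map hF (by fun_prop), lintegral_prod _ (by fun_prop)]
  refine lintegral_congr fun s => ?_
  rw [lintegral_prod _ (by fun_prop)]

lemma flowLoss_eq_lintegral {v : ℝ × V × A → V} (hv : Measurable v) :
    flowLoss ρ v
      = ∫⁻ s in Set.Icc (0 : ℝ) 1, ∫⁻ q, ∫⁻ w,
          ‖v (s, (1 - s) • w + s • q.2, q.1) - (q.2 - w)‖ₑ ^ 2 ∂(stdGaussian V) ∂ρ := by
  rw [flowLoss, regressionLoss, lintegral_flowLaw (by fun_prop)]
  refine lintegral_congr_ae ?_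
  filter_upwards [ae_timeLaw_mem_Ioo] with s hs
  simp_rw [flowTarget_interp hs.2.ne]

lemma flowLoss_map_eq_lintegral {C : Type*} [MeasurableSpace C] {μ : Measure C} [SFinite μ]
    {T : C → A × V} (hT : Measurable T) {v : ℝ × V × A → V} (hv : Measurable v) :
    flowLoss (μ.map T) v
      = ∫⁻ s in Set.Icc (0 : ℝ) 1, ∫⁻ c, ∫⁻ w,
          ‖v (s, (1 - s) • w + s • (T c).2, (T c).1) - ((T c).2 - w)‖ₑ ^ 2
            ∂(stdGaussian V) ∂μ := by
  rw [flowLoss_eq_lintegral hv]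
  refine lintegral_congr fun s => lintegral_map ?_ hT
  exact Measurable.lintegral_prod_right' (f := fun x : (A × V) × V =>
    ‖v (s, (1 - s) • x.2 + s • x.1.2, x.1.1) - (x.1.2 - x.2)‖ₑ ^ 2) (by fun_prop)

lemma flowLoss_map {A' : Type*} [MeasurableSpace A'] {r : A' → A} (hr : Measurable r)
    {ρ : Measure (A' × V)} [SFinite ρ] {v : ℝ × V × A → V} (hv : Measurable v) :
    flowLoss (ρ.map (Prod.map r id)) v = flowLoss ρ fun x => v (x.1, x.2.1, r x.2.2) := by
  rw [flowLoss_map_eq_lintegral (by fun_prop) hv, flowLoss_eq_lintegral (by fun_prop)]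
  rfl

end PushForward

lemma measurable_logWeight_kernel :
    Measurable fun q : (ℝ × V × A) × V => logWeight q.1.1 q.1.2.1 q.2 := by
  unfold logWeight
  fun_prop

/-- If `κ a` is the law of `b`, then `posteriorKernel κ (s, z, a)` is the conditional law of `b`
given `(1 - s) • w + s • b = z`. -/
noncomputable def posteriorKernel (κ : Kernel A V) [IsMarkovKernel κ] : Kernel (ℝ × V × A) V :=
  tiltedKernel (liftKernel κ) fun q => logWeight q.1.1 q.1.2.1 q.2

/-- The law of `(s, (1 - s) • w + s • b, a)` for `(a, b) ∼ π ⊗ₘ κ`, in the notation of `flowLaw`. -/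
noncomputable def flowMarginal (π : Measure A) (κ : Kernel A V) : Measure (ℝ × V × A) :=
  ((timeLaw.prod (volume.prod π)).withDensity fun x =>
    ENNReal.ofReal (channelConst V x.1)).withDensity fun x =>
      ENNReal.ofReal (∫ y, Real.exp (logWeight x.1 x.2.1 y) ∂(liftKernel κ x))

instance sFinite_flowMarginal (π : Measure A) [SFinite π] (κ : Kernel A V) :
    SFinite (flowMarginal π κ) := by
  unfold flowMarginal
  infer_instance

/-- The minimizer of the flow-matching loss for `(a, b) ∼ π ⊗ₘ κ`: the conditional mean of the
target. -/
noncomputable def flowVelocity (κ : Kernel A V) [IsMarkovKernel κ] : ℝ × V × A → V :=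
  regressionMean (posteriorKernel κ) flowTarget

section Disintegration

variable {π : Measure A} {κ κ' : Kernel A V} [IsMarkovKernel κ] [IsMarkovKernel κ']

lemma posteriorKernel_apply (x : ℝ × V × A) :
    posteriorKernel κ x = posterior (κ x.2.2) x.1 x.2.1 :=
  tiltedKernel_apply measurable_logWeight_kernel x

instance isMarkovKernel_posteriorKernel : IsMarkovKernel (posteriorKernel κ) :=
  isMarkovKernel_tiltedKernel measurable_logWeight_kernel integrable_exp_logWeight_liftKernel

lemma measurable_flowVelocity : Measurable (flowVelocity κ) :=
  measurable_regressionMean measurable_flowTarget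

lemma flowVelocity_apply {s : ℝ} (hs : s ∈ Set.Ioo 0 1) (z : V) (a : A) :
    flowVelocity κ (s, z, a) = (1 - s)⁻¹ • (∫ y, y ∂(posterior (κ a) s z) - z) := by
  have := isProbabilityMeasure_posterior (κ a) s z
  have hint : Integrable (fun y => y) (posterior (κ a) s z) :=
    (memLp_two_id_posterior (κ a) hs z).integrable one_le_two
  simp_rw [flowVelocity, regressionMean, posteriorKernel_apply, flowTarget]
  rw [integral_smul, integral_sub hint (integrable_const z)]
  simp

lemma ae_flowMarginal : ae (flowMarginal π κ) = ae (timeLaw.prod (volume.prod π)) := by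
  have hZ : Measurable fun x : ℝ × V × A =>
      ENNReal.ofReal (∫ y, Real.exp (logWeight x.1 x.2.1 y) ∂(liftKernel κ x)) :=
    (measurable_integral_exp measurable_logWeight_kernel).ennreal_ofReal
  refine le_antisymm ((withDensity_absolutelyContinuous _ _).trans
    (withDensity_absolutelyContinuous _ _)).ae_le (Measure.AbsolutelyContinuous.trans
      (withDensity_absolutelyContinuous' (by fun_prop) ?_)
      (withDensity_absolutelyContinuous' hZ.aemeasurable ?_)).ae_le
  · filter_upwards [Measure.quasiMeasurePreserving_fst.ae ae_timeLaw_mem_Ioo] with x hx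
    simpa using channelConst_pos hx.2.ne
  · refine ae_of_all _ fun x => ?_
    simpa using integral_exp_pos (integrable_exp_logWeight_liftKernel (κ := κ) x)

lemma memLp_two_flowTarget : ∀ᵐ x ∂(flowMarginal π κ),
    MemLp (fun y => flowTarget (x, y)) 2 (posteriorKernel κ x) := by
  rw [ae_flowMarginal]
  filter_upwards [Measure.quasiMeasurePreserving_fst.ae ae_timeLaw_mem_Ioo] with x hx
  rw [posteriorKernel_apply]
  have := isProbabilityMeasure_posterior (κ x.2.2) x.1 x.2.1
  have hsub : MemLp (fun y => y - x.2.1) 2 (posterior (κ x.2.2) x.1 x.2.1) :=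
    (memLp_two_id_posterior _ hx _).sub (memLp_const _)
  exact hsub.const_smul (1 - x.1)⁻¹

variable [SFinite π]

lemma lintegral_flowLaw_compProd {F : (ℝ × V × A) × V → ℝ≥0∞} (hF : Measurable F) :
    ∫⁻ x, F x ∂(flowLaw (π ⊗ₘ κ))
      = ∫⁻ x, ∫⁻ b, ENNReal.ofReal (channelConst V x.1 * Real.exp (logWeight x.1 x.2.1 b))
          * F (x, b) ∂(liftKernel κ x) ∂(timeLaw.prod (volume.prod π)) := by
  have hlw := measurable_logWeight_kernel (A := A) (V := V)
  set G : (ℝ × V × A) × V → ℝ≥0∞ := fun q =>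
    ENNReal.ofReal (channelConst V q.1.1 * Real.exp (logWeight q.1.1 q.1.2.1 q.2)) * F q
  have hG : Measurable G := by fun_prop
  have hGκ : Measurable fun x => ∫⁻ b, G (x, b) ∂(liftKernel κ x) :=
    hG.lintegral_kernel_prod_right'
  rw [lintegral_flowLaw hF, lintegral_prod _ hGκ.aemeasurable]
  refine lintegral_congr_ae ?_
  filter_upwards [ae_timeLaw_mem_Ioo] with s hs
  calc ∫⁻ q, ∫⁻ w, F ((s, (1 - s) • w + s • q.2, q.1), q.2) ∂(stdGaussian V) ∂(π ⊗ₘ κ)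
      = ∫⁻ q, ∫⁻ z, G ((s, z, q.1), q.2) ∂volume ∂(π ⊗ₘ κ) :=
        lintegral_congr fun q => lintegral_interp_stdGaussian hs.2.ne q.2
          (f := fun z => F ((s, z, q.1), q.2)) (by fun_prop)
    _ = ∫⁻ a, ∫⁻ b, ∫⁻ z, G ((s, z, a), b) ∂volume ∂(κ a) ∂π :=
        Measure.lintegral_compProd <| Measurable.lintegral_prod_right'
          (f := fun x : (A × V) × V => G ((s, x.2, x.1.1), x.1.2)) (by fun_prop)
    _ = ∫⁻ a, ∫⁻ z, ∫⁻ b, G ((s, z, a), b) ∂(κ a) ∂volume ∂π :=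
        lintegral_congr fun a => lintegral_lintegral_swap (by fun_prop)
    _ = ∫⁻ x, ∫⁻ b, G ((s, x), b) ∂(liftKernel κ (s, x)) ∂(volume.prod π) :=
        (lintegral_prod_symm _ (hGκ.comp measurable_prodMk_left).aemeasurable).symm

theorem flowLaw_compProd : flowLaw (π ⊗ₘ κ) = flowMarginal π κ ⊗ₘ posteriorKernel κ := by
  have hlw := measurable_logWeight_kernel (A := A) (V := V)
  rw [flowMarginal, posteriorKernel,
    ← withDensity_exp_compProd _ hlw integrable_exp_logWeight_liftKernel]
  refine Measure.ext_of_lintegral _ fun F hF => ?_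
  have hFκ : Measurable fun x => ∫⁻ b, ENNReal.ofReal (Real.exp (logWeight x.1 x.2.1 b))
      * F (x, b) ∂(liftKernel κ x) :=
    Measurable.lintegral_kernel_prod_right' (f := fun q : (ℝ × V × A) × V =>
      ENNReal.ofReal (Real.exp (logWeight q.1.1 q.1.2.1 q.2)) * F q) (by fun_prop)
  rw [lintegral_flowLaw_compProd hF, lintegral_withDensity_eq_lintegral_mul _ (by fun_prop) hF,
    Measure.lintegral_compProd (by fun_prop),
    lintegral_withDensity_eq_lintegral_mul _ (by fun_prop)
      (by simpa only [Pi.mul_apply] using hFκ)]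
  refine lintegral_congr_ae ?_
  filter_upwards [Measure.quasiMeasurePreserving_fst.ae ae_timeLaw_mem_Ioo] with x hx
  simp only [Pi.mul_apply]
  rw [← lintegral_const_mul' _ _ ENNReal.ofReal_ne_top]
  simp_rw [← mul_assoc, ← ENNReal.ofReal_mul (channelConst_pos hx.2.ne).le]

lemma flowLoss_flowVelocity_le {v : ℝ × V × A → V} (hv : Measurable v) :
    flowLoss (π ⊗ₘ κ) (flowVelocity κ) ≤ flowLoss (π ⊗ₘ κ) v := by
  unfold flowLoss
  rw [flowLaw_compProd]
  exact regressionLoss_regressionMean_le measurable_flowTarget memLp_two_flowTarget hv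

lemma flowLoss_eq_iff_ae_eq_flowVelocity {v : ℝ × V × A → V} (hv : Measurable v)
    (hfin : flowLoss (π ⊗ₘ κ) (flowVelocity κ) < ∞) :
    flowLoss (π ⊗ₘ κ) v = flowLoss (π ⊗ₘ κ) (flowVelocity κ)
      ↔ v =ᵐ[timeLaw.prod (volume.prod π)] flowVelocity κ := by
  unfold flowLoss at hfin ⊢
  rw [flowLaw_compProd] at hfin ⊢
  rw [flowVelocity, regressionLoss_eq_iff_ae_eq_regressionMean measurable_flowTarget
    memLp_two_flowTarget hv hfin, Filter.EventuallyEq, ae_flowMarginal, Filter.EventuallyEq]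

theorem flowVelocity_ae_eq_iff :
    flowVelocity κ =ᵐ[timeLaw.prod (volume.prod π)] flowVelocity κ' ↔ κ =ᵐ[π] κ' := by
  constructor <;> intro h
  · have : NeZero (timeLaw) := ⟨by simp [timeLaw, Measure.restrict_eq_zero]⟩
    obtain ⟨s, hs, hsIoo⟩ := ((Measure.ae_ae_of_ae_prod h).and ae_timeLaw_mem_Ioo).exists
    have hswap := Measure.ae_ae_of_ae_prod
      ((Measure.measurePreserving_swap (μ := π) (ν := volume)).quasiMeasurePreserving.ae hs)
    filter_upwards [hswap] with a ha
    refine eq_of_integral_id_posterior_ae_eq hsIoo (ha.mono fun z hz => ?_)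
    simpa [flowVelocity_apply hsIoo, sub_ne_zero.2 hsIoo.2.ne'] using hz
  · have hsnd : Measure.QuasiMeasurePreserving (fun x : ℝ × V × A => x.2.2)
        (timeLaw.prod (volume.prod π)) π :=
      Measure.quasiMeasurePreserving_snd.comp Measure.quasiMeasurePreserving_snd
    filter_upwards [hsnd.ae h] with x hx
    simp only [flowVelocity, regressionMean, posteriorKernel_apply, hx]

end Disintegration

end FlowMatching

/-! ### Conditional laws that factor through a map -/

section Factorization

variable {A B U : Type*} [MeasurableSpace A] [MeasurableSpace B] [MeasurableSpace U]
  {r : A → U} {hr : Measurable r}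

/-- For `(a, b) ∼ ρ`, the conditional law of `b` given `a` depends on `a` only through `r a`. -/
def CondLawFactorsThrough (ρ : Measure (A × B)) (r : A → U) (hr : Measurable r) : Prop :=
  ∃ K : Kernel U B, IsFiniteKernel K ∧ ρ = ρ.fst ⊗ₘ K.comap r hr

lemma map_prodMap_compProd_comap (π : Measure A) [SFinite π] (K : Kernel U B) [IsSFiniteKernel K]
    (hr : Measurable r) :
    (π ⊗ₘ K.comap r hr).map (Prod.map r id) = π.map r ⊗ₘ K := by
  refine Measure.ext_of_lintegral _ fun F hF => ?_
  rw [lintegral_map hF (by fun_prop), Measure.lintegral_compProd (by fun_prop),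
    Measure.lintegral_compProd hF, lintegral_map hF.lintegral_kernel_prod_right' hr]
  rfl

lemma fst_map_prodMap {C : Type*} [MeasurableSpace C] (ρ : Measure (A × B)) (hr : Measurable r)
    {g : B → C} (hg : Measurable g) : (ρ.map (Prod.map r g)).fst = ρ.fst.map r := by
  rw [Measure.fst, Measure.fst, Measure.map_map measurable_fst (by fun_prop),
    Measure.map_map hr measurable_fst]
  rfl

theorem condLawFactorsThrough_iff_condKernel_ae_eq [StandardBorelSpace B] [Nonempty B]
    {ρ : Measure (A × B)} [IsFiniteMeasure ρ] :
    CondLawFactorsThrough ρ r hr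
      ↔ ρ.condKernel =ᵐ[ρ.fst] (ρ.map (Prod.map r id)).condKernel.comap r hr := by
  constructor
  · rintro ⟨K, hK, hρ⟩
    have hmap : ρ.map (Prod.map r id) = (ρ.map (Prod.map r id)).fst ⊗ₘ K := by
      rw [fst_map_prodMap ρ hr measurable_id, ← map_prodMap_compProd_comap ρ.fst K hr, ← hρ]
    have hK' := eq_condKernel_of_measure_eq_compProd K hmap
    rw [fst_map_prodMap ρ hr measurable_id] at hK'
    filter_upwards [eq_condKernel_of_measure_eq_compProd (K.comap r hr) hρ,
      ae_of_ae_map hr.aemeasurable hK'] with a ha ha'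
    rw [← ha, Kernel.comap_apply, Kernel.comap_apply, ha']
  · intro h
    refine ⟨(ρ.map (Prod.map r id)).condKernel, inferInstance, ?_⟩
    rw [← Measure.compProd_congr h, ρ.disintegrate ρ.condKernel]

theorem condLawFactorsThrough_map_iff {C : Type*} [MeasurableSpace C] {ι : B → C}
    (hι : MeasurableEmbedding ι) {ρ : Measure (A × B)} [IsFiniteMeasure ρ] :
    CondLawFactorsThrough (ρ.map (Prod.map id ι)) r hr ↔ CondLawFactorsThrough ρ r hr := by
  have hfst : (ρ.map (Prod.map id ι)).fst = ρ.fst := by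
    rw [fst_map_prodMap ρ measurable_id hι.measurable, Measure.map_id]
  rw [CondLawFactorsThrough, hfst]
  constructor <;> rintro ⟨K, hK, hρ⟩
  · refine ⟨K.comapRight hι, inferInstance, Measure.ext_prod fun {s t} hs ht => ?_⟩
    have himage : Prod.map id ι ⁻¹' (s ×ˢ (ι '' t)) = s ×ˢ t := by
      ext ⟨a, b⟩
      simp [hι.injective.mem_set_image]
    calc ρ (s ×ˢ t) = ρ.map (Prod.map id ι) (s ×ˢ (ι '' t)) := by
          rw [(MeasurableEmbedding.id.prodMap hι).map_apply, himage]
      _ = ∫⁻ a in s, K (r a) (ι '' t) ∂ρ.fst := by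
          rw [hρ, Measure.compProd_apply_prod hs (hι.measurableSet_image.2 ht)]
          rfl
      _ = (ρ.fst ⊗ₘ (K.comapRight hι).comap r hr) (s ×ˢ t) := by
          simp_rw [Measure.compProd_apply_prod hs ht, Kernel.comap_apply,
            Kernel.comapRight_apply' _ hι _ ht]
  · refine ⟨K.map ι, inferInstance, ?_⟩
    have hmap : (K.map ι).comap r hr = (K.comap r hr).map ι := by
      ext a
      simp [Kernel.map_apply _ hι.measurable]
    rw [hmap, Measure.compProd_map hι.measurable, ← hρ]

/-- The conditional law is `K` normalized; where the normalization fails, `K` is zero or `π` has no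
mass. -/
lemma condLawFactorsThrough_compProd_comap {π : Measure A} [SFinite π] {K : Kernel U B}
    [IsSFiniteKernel K] [IsFiniteMeasure (π ⊗ₘ K.comap r hr)] :
    CondLawFactorsThrough (π ⊗ₘ K.comap r hr) r hr := by
  have hZ : Measurable fun u => K u Set.univ := K.measurable_coe .univ
  set K' : Kernel U B := K.withDensity fun u _ => (K u Set.univ)⁻¹
  have lintegral_K' (u : U) {F : B → ℝ≥0∞} (hF : Measurable F) :
      ∫⁻ b, F b ∂(K' u) = (K u Set.univ)⁻¹ * ∫⁻ b, F b ∂(K u) := by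
    rw [Kernel.lintegral_withDensity _ (by fun_prop) _ hF, lintegral_const_mul _ hF]
  have : IsFiniteKernel K' := by
    refine ⟨1, ENNReal.one_lt_top, fun u => ?_⟩
    rw [← lintegral_one, lintegral_K' u measurable_const, lintegral_one, mul_comm]
    exact ENNReal.mul_inv_le_one _
  have hfin : ∀ᵐ a ∂π, K (r a) Set.univ < ∞ := by
    refine ae_lt_top (hZ.comp hr) ?_
    have := measure_ne_top (π ⊗ₘ K.comap r hr) (Set.univ ×ˢ Set.univ)
    rwa [Measure.compProd_apply_prod .univ .univ, Measure.restrict_univ] at this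
  refine ⟨K', inferInstance, Measure.ext_of_lintegral _ fun F hF => ?_⟩
  have hG : Measurable fun a => ∫⁻ b, F (a, b) ∂(K'.comap r hr a) := hF.lintegral_kernel_prod_right'
  rw [Measure.lintegral_compProd hF, Measure.lintegral_compProd hF, Measure.fst,
    lintegral_map hG measurable_fst,
    Measure.lintegral_compProd (f := fun q => ∫⁻ b, F (q.1, b) ∂(K'.comap r hr q.1))
      (hG.comp measurable_fst)]
  refine lintegral_congr_ae (hfin.mono fun a ha => ?_)
  simp only [Kernel.comap_apply, lintegral_const]
  rw [lintegral_K' (r a) (by fun_prop)]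
  by_cases h0 : K (r a) Set.univ = 0
  · simp [Measure.measure_univ_eq_zero.1 h0]
  · rw [mul_right_comm, ENNReal.inv_mul_cancel h0 ha.ne, one_mul]

lemma compProd_comap_withDensity_const (π : Measure A) [SFinite π] (β : Measure B) [SFinite β]
    {f : U × B → ℝ≥0} (hf : Measurable f) (hr : Measurable r) :
    π ⊗ₘ ((Kernel.const U β).withDensity fun u b => f (u, b)).comap r hr
      = (π.prod β).withDensity fun q => f (r q.1, q.2) := by
  have hcomap : ((Kernel.const U β).withDensity fun u b => f (u, b)).comap r hr
      = (Kernel.const A β).withDensity fun a b => f (r a, b) := by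
    ext a : 1
    rw [Kernel.comap_apply, Kernel.withDensity_apply _ (by fun_prop),
      Kernel.withDensity_apply _ (by fun_prop), Kernel.const_apply, Kernel.const_apply]
  rw [hcomap, Measure.compProd_withDensity (by fun_prop), Measure.compProd_const]

lemma condLawFactorsThrough_of_eq_withDensity {ρ : Measure (A × B)} [IsFiniteMeasure ρ]
    {π : Measure A} [SFinite π] {β : Measure B} [SFinite β] {f : U × B → ℝ≥0} (hf : Measurable f)
    (hρ : ρ = (π.prod β).withDensity fun q => (f (r q.1, q.2) : ℝ≥0∞)) :
    CondLawFactorsThrough ρ r hr := by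
  rw [← compProd_comap_withDensity_const π β hf hr] at hρ
  subst hρ
  exact condLawFactorsThrough_compProd_comap

lemma fst_withDensity_prod {α : Measure A} {β : Measure B} [SFinite α] [SFinite β]
    {g : A × B → ℝ≥0∞} (hg : Measurable g) :
    ((α.prod β).withDensity g).fst = α.withDensity fun a => ∫⁻ b, g (a, b) ∂β := by
  ext s hs
  rw [Measure.fst_apply hs, ← Set.prod_univ, withDensity_apply _ (hs.prod .univ),
    withDensity_apply _ hs, setLIntegral_prod _ hg.aemeasurable.restrict]
  simp

/-- Mathlib's Radon–Nikodym derivative of kernels needs a finite reference kernel, hence the detour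
through `β.toFinite`. -/
lemma exists_measurable_density (K : Kernel U B) [IsFiniteKernel K] (β : Measure B)
    [SigmaFinite β] [MeasurableSpace.CountableOrCountablyGenerated U B] :
    ∃ f : U × B → ℝ≥0, Measurable f ∧
      ∀ u, K u ≪ β → K u = β.withDensity fun b => f (u, b) := by
  set k : U × B → ℝ≥0∞ := fun q =>
    β.toFinite.rnDeriv β q.2 * K.rnDeriv (Kernel.const U β.toFinite) q.1 q.2
  refine ⟨fun q => (k q).toNNReal, by fun_prop, fun u hu => ?_⟩
  have hK : K u = β.withDensity fun b => k (u, b) := by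
    have hac : K u ≪ Kernel.const U β.toFinite u := hu.trans (absolutelyContinuous_toFinite β)
    calc K u = β.toFinite.withDensity (K.rnDeriv (Kernel.const U β.toFinite) u) := by
          rw [← Kernel.withDensity_rnDeriv_eq hac, Kernel.withDensity_apply _ (by fun_prop),
            Kernel.const_apply]
      _ = (β.withDensity (β.toFinite.rnDeriv β)).withDensity
            (K.rnDeriv (Kernel.const U β.toFinite) u) := by
          rw [Measure.withDensity_rnDeriv_eq _ _ (toFinite_absolutelyContinuous β)]
      _ = β.withDensity fun b => k (u, b) :=
          (withDensity_mul _ (by fun_prop) (by fun_prop)).symm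
  have hfin : ∀ᵐ b ∂β, k (u, b) < ∞ :=
    ae_lt_top (by fun_prop) (by
      rw [← setLIntegral_univ, ← withDensity_apply _ .univ, ← hK]
      exact measure_ne_top _ _)
  rw [hK]
  refine withDensity_congr_ae (hfin.mono fun b hb => ?_)
  simp only [ENNReal.coe_toNNReal hb.ne]

theorem CondLawFactorsThrough.exists_density_eq
    [MeasurableSpace.CountableOrCountablyGenerated U B]
    [MeasurableSpace.CountableOrCountablyGenerated A B] {α : Measure A} [SFinite α] {β : Measure B}
    [SigmaFinite β] {ρ : Measure (A × B)} [IsFiniteMeasure ρ]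
    (h : CondLawFactorsThrough ρ r hr) {g : A × B → ℝ≥0∞} (hg : Measurable g)
    (hρ : ρ = (α.prod β).withDensity g) :
    ∃ f : U × B → ℝ≥0, Measurable f ∧
      ∀ᵐ q ∂(α.prod β), g q = (∫⁻ b, g (q.1, b) ∂β) * f (r q.1, q.2) := by
  obtain ⟨K, hK, hρK⟩ := h
  obtain ⟨f, hf, hKf⟩ := exists_measurable_density K β
  have hac : ∀ᵐ a ∂ρ.fst, K (r a) ≪ β := by
    have : ρ.fst ⊗ₘ K.comap r hr ≪ α ⊗ₘ Kernel.const A β.toFinite := by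
      rw [← hρK, Measure.compProd_const, hρ]
      exact (withDensity_absolutelyContinuous _ _).trans
        (Measure.AbsolutelyContinuous.rfl.prod (absolutelyContinuous_toFinite β))
    filter_upwards [this.kernel_of_compProd] with a ha
    exact ha.trans (toFinite_absolutelyContinuous β)
  have hdensity : ρ = (ρ.fst.prod β).withDensity fun q => (f (r q.1, q.2) : ℝ≥0∞) := by
    rw [← compProd_comap_withDensity_const ρ.fst β hf hr]
    refine hρK.trans (Measure.compProd_congr (hac.mono fun a ha => ?_))
    rw [Kernel.comap_apply, Kernel.comap_apply, Kernel.withDensity_apply _ (by fun_prop),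
      Kernel.const_apply, hKf _ ha]
  have hm : Measurable fun a => ∫⁻ b, g (a, b) ∂β := hg.lintegral_prod_right'
  refine ⟨f, hf, (withDensity_eq_iff hg.aemeasurable (by fun_prop) ?_).1 ?_⟩
  · rw [← setLIntegral_univ, ← withDensity_apply _ .univ, ← hρ]
    exact measure_ne_top ρ _
  · rw [← hρ, hdensity, hρ, fst_withDensity_prod hg, prod_withDensity_left hm,
      ← withDensity_mul _ (by fun_prop) (by fun_prop)]
    rfl

end Factorization

/-! ### Minimal losses -/

section MinFlowLoss

variable {A B V : Type*} [MeasurableSpace A] [MeasurableSpace B]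
  [NormedAddCommGroup V] [InnerProductSpace ℝ V] [FiniteDimensional ℝ V] [MeasurableSpace V]
  [BorelSpace V]

/-- The least value of `flowLoss ρ`, attained at the velocity of the conditional law of `ρ`. -/
noncomputable def minFlowLoss (ρ : Measure (A × V)) [IsFiniteMeasure ρ] : ℝ≥0∞ :=
  flowLoss ρ (flowVelocity ρ.condKernel)

theorem isLeast_minFlowLoss (ρ : Measure (A × V)) [IsFiniteMeasure ρ] :
    IsLeast (flowLoss ρ '' {v | Measurable v}) (minFlowLoss ρ) := by
  refine ⟨Set.mem_image_of_mem _ measurable_flowVelocity, ?_⟩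
  rintro _ ⟨v, hv, rfl⟩
  have h := flowLoss_flowVelocity_le (π := ρ.fst) (κ := ρ.condKernel) hv
  rwa [ρ.disintegrate ρ.condKernel] at h

variable {r : A → B}

lemma flowVelocity_comap (κ : Kernel B V) [IsMarkovKernel κ] (hr : Measurable r) :
    flowVelocity (κ.comap r hr) = fun x => flowVelocity κ (x.1, x.2.1, r x.2.2) := by
  funext x
  simp only [flowVelocity, regressionMean, posteriorKernel_apply, Kernel.comap_apply, flowTarget]

lemma minFlowLoss_map (ρ : Measure (A × V)) [IsFiniteMeasure ρ] (hr : Measurable r) :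
    minFlowLoss (ρ.map (Prod.map r id))
      = flowLoss ρ (flowVelocity ((ρ.map (Prod.map r id)).condKernel.comap r hr)) := by
  rw [minFlowLoss, flowLoss_map hr measurable_flowVelocity, flowVelocity_comap]

theorem minFlowLoss_le_minFlowLoss_map (ρ : Measure (A × V)) [IsFiniteMeasure ρ]
    (hr : Measurable r) : minFlowLoss ρ ≤ minFlowLoss (ρ.map (Prod.map r id)) := by
  rw [minFlowLoss_map ρ hr]
  exact (isLeast_minFlowLoss ρ).2 (Set.mem_image_of_mem _ measurable_flowVelocity)

theorem minFlowLoss_map_eq_iff {ρ : Measure (A × V)} [IsFiniteMeasure ρ] (hr : Measurable r)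
    (hfin : minFlowLoss ρ < ∞) :
    minFlowLoss (ρ.map (Prod.map r id)) = minFlowLoss ρ ↔ CondLawFactorsThrough ρ r hr := by
  have h := flowLoss_eq_iff_ae_eq_flowVelocity (π := ρ.fst) (κ := ρ.condKernel)
    (measurable_flowVelocity (κ := (ρ.map (Prod.map r id)).condKernel.comap r hr))
  rw [ρ.disintegrate ρ.condKernel] at h
  rw [minFlowLoss_map ρ hr, minFlowLoss, h hfin, flowVelocity_ae_eq_iff,
    condLawFactorsThrough_iff_condKernel_ae_eq]
  exact ⟨Filter.EventuallyEq.symm, Filter.EventuallyEq.symm⟩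

lemma add_eq_add_iff_of_le {a₀ a₁ b₀ b₁ : ℝ≥0∞} (h₀ : a₀ ≤ b₀) (h₁ : a₁ ≤ b₁)
    (ha₀ : a₀ < ∞) (ha₁ : a₁ < ∞) : b₀ + b₁ = a₀ + a₁ ↔ b₀ = a₀ ∧ b₁ = a₁ := by
  refine ⟨fun h => ⟨?_, ?_⟩, fun h => by rw [h.1, h.2]⟩
  · refine le_antisymm ((ENNReal.add_le_add_iff_right ha₁.ne).1 ?_) h₀
    exact (add_le_add le_rfl h₁).trans h.le
  · refine le_antisymm ((ENNReal.add_le_add_iff_left ha₀.ne).1 ?_) h₁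
    exact (add_le_add h₀ le_rfl).trans h.le

end MinFlowLoss

/-! ### Transition densities -/

section TransitionDensity

variable {D d : ℕ} {X : Set (E D)} {p : X → X → ℝ≥0} {ρ₀ : X → ℝ≥0} {r : X → E d}

lemma sigmaFinite_leb (hX : MeasurableSet X) : SigmaFinite (leb X) := by
  have h : SigmaFinite ((leb X).map Subtype.val) := by
    rw [leb, (MeasurableEmbedding.subtype_coe hX).map_comap, Subtype.range_coe]
    infer_instance
  exact SigmaFinite.of_map _ measurable_subtype_coe.aemeasurable h

/-- The law of the initial state `X_t`. -/
noncomputable def initialLaw (ρ₀ : X → ℝ≥0) : Measure X :=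
  (leb X).withDensity fun x => (ρ₀ x : ℝ≥0∞)

lemma IsProbDensity.isProbabilityMeasure_initialLaw (hρ₀ : IsProbDensity ρ₀) :
    IsProbabilityMeasure (initialLaw ρ₀) :=
  ⟨by rw [initialLaw, withDensity_apply _ .univ, setLIntegral_univ, hρ₀.lintegral_eq_one]⟩

/-- The law of the time-reversed pair `(X_{t+τ}, X_t)`. -/
noncomputable def reversedLaw (p : X → X → ℝ≥0) (ρ₀ : X → ℝ≥0) : Measure (X × X) :=
  (jointLaw p ρ₀).map Prod.swap

instance isFiniteMeasure_reversedLaw [IsFiniteMeasure (jointLaw p ρ₀)] :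
    IsFiniteMeasure (reversedLaw p ρ₀) :=
  Measure.isFiniteMeasure_map _ _

section Density

variable [SigmaFinite (leb X)]

lemma jointLaw_eq_withDensity (hρ₀ : Measurable ρ₀) (hp : Measurable fun q : X × X => p q.1 q.2) :
    jointLaw p ρ₀
      = ((initialLaw ρ₀).prod (leb X)).withDensity fun q => (p q.1 q.2 : ℝ≥0∞) := by
  rw [initialLaw, prod_withDensity_left (by fun_prop),
    ← withDensity_mul _ (by fun_prop) (by fun_prop)]
  rfl

lemma reversedLaw_eq_withDensity [SFinite (initialLaw ρ₀)] (hρ₀ : Measurable ρ₀)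
    (hp : Measurable fun q : X × X => p q.1 q.2) :
    reversedLaw p ρ₀
      = ((leb X).prod (initialLaw ρ₀)).withDensity fun q => (p q.2 q.1 : ℝ≥0∞) := by
  refine Measure.ext_of_lintegral _ fun f hf => ?_
  rw [reversedLaw, jointLaw_eq_withDensity hρ₀ hp, lintegral_map hf measurable_swap,
    lintegral_withDensity_eq_lintegral_mul _ (by fun_prop) (by fun_prop),
    lintegral_withDensity_eq_lintegral_mul _ (by fun_prop) hf, ← lintegral_prod_swap]
  rfl

lemma isProbabilityMeasure_jointLaw (hp : IsTransitionDensity p) (hρ₀ : IsProbDensity ρ₀) :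
    IsProbabilityMeasure (jointLaw p ρ₀) := by
  have := hρ₀.isProbabilityMeasure_initialLaw
  have hp' := hp.measurable
  constructor
  rw [jointLaw_eq_withDensity hρ₀.measurable hp.measurable, withDensity_apply _ .univ,
    setLIntegral_univ, lintegral_prod _ (by fun_prop)]
  simp [hp.lintegral_eq_one]

theorem lumpable_iff_condLawFactorsThrough (hp : IsTransitionDensity p) (hρ₀ : IsProbDensity ρ₀)
    (hr : Measurable r) : Lumpable p ρ₀ r ↔ CondLawFactorsThrough (jointLaw p ρ₀) r hr := by
  have := isProbabilityMeasure_jointLaw hp hρ₀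
  have := hρ₀.isProbabilityMeasure_initialLaw
  have hp' := hp.measurable
  have hdensity := jointLaw_eq_withDensity hρ₀.measurable hp.measurable
  constructor
  · rintro ⟨pL, hpL, h⟩
    refine condLawFactorsThrough_of_eq_withDensity (π := initialLaw ρ₀) (β := leb X) hpL
      (hdensity.trans ?_)
    exact withDensity_congr_ae (h.mono fun q hq => by simp only [hq])
  · intro h
    obtain ⟨pL, hpL, h⟩ := h.exists_density_eq (by fun_prop) hdensity
    refine ⟨pL, hpL, h.mono fun q hq => ?_⟩
    simpa only [hp.lintegral_eq_one, one_mul, ENNReal.coe_inj] using hq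

theorem decomposable_iff_condLawFactorsThrough (hp : IsTransitionDensity p)
    (hρ₀ : IsProbDensity ρ₀) (hr : Measurable r) :
    Decomposable p ρ₀ r ↔ CondLawFactorsThrough (reversedLaw p ρ₀) r hr := by
  have := isProbabilityMeasure_jointLaw hp hρ₀
  have := hρ₀.isProbabilityMeasure_initialLaw
  have hp' := hp.measurable
  have hdensity := reversedLaw_eq_withDensity hρ₀.measurable hp.measurable
  constructor
  · rintro ⟨pD, pLocal, hpD, hpLocal, h⟩
    have hswap : MeasurePreserving Prod.swap ((leb X).prod (initialLaw ρ₀)) (refMeasure ρ₀) :=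
      Measure.measurePreserving_swap
    have hf : Measurable fun q : E d × X => pD (q.2, q.1) := by fun_prop
    refine condLawFactorsThrough_of_eq_withDensity
      (π := (leb X).withDensity fun y => (pLocal (r y, y) : ℝ≥0∞)) (β := initialLaw ρ₀) hf ?_
    rw [hdensity, prod_withDensity_left (by fun_prop),
      ← withDensity_mul _ (by fun_prop) (by fun_prop)]
    refine withDensity_congr_ae ((hswap.quasiMeasurePreserving.ae h).mono fun q hq => ?_)
    simp only [Prod.fst_swap, Prod.snd_swap] at hq
    simp [hq, mul_comm]
  · intro h
    have hswap : MeasurePreserving Prod.swap (refMeasure ρ₀) ((leb X).prod (initialLaw ρ₀)) :=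
      Measure.measurePreserving_swap
    obtain ⟨f, hf, h⟩ := h.exists_density_eq (by fun_prop) hdensity
    have hm : Measurable fun y => ∫⁻ x, (p x y : ℝ≥0∞) ∂(initialLaw ρ₀) :=
      Measurable.lintegral_prod_right' (f := fun q : X × X => (p q.2 q.1 : ℝ≥0∞)) (by fun_prop)
    have hm_lt_top : ∀ᵐ y ∂(leb X), ∫⁻ x, (p x y : ℝ≥0∞) ∂(initialLaw ρ₀) < ∞ := by
      refine ae_lt_top hm ?_
      rw [← setLIntegral_univ, ← withDensity_apply _ .univ,
        ← fst_withDensity_prod (g := fun q => (p q.2 q.1 : ℝ≥0∞)) (by fun_prop), ← hdensity]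
      exact measure_ne_top _ _
    refine ⟨fun q => f (q.2, q.1), fun q => (∫⁻ x, (p x q.2 : ℝ≥0∞) ∂(initialLaw ρ₀)).toNNReal,
      by fun_prop, (hm.comp measurable_snd).ennreal_toNNReal, ?_⟩
    filter_upwards [hswap.quasiMeasurePreserving.ae h,
      Measure.quasiMeasurePreserving_snd.ae hm_lt_top] with q hq hq_lt_top
    rw [← ENNReal.coe_inj, ENNReal.coe_mul, ENNReal.coe_toNNReal hq_lt_top.ne, mul_comm]
    exact hq

end Density

/-- The law of the pair (conditioning variable, target) in the forward loss. -/
noncomputable def forwardLaw (p : X → X → ℝ≥0) (ρ₀ : X → ℝ≥0) : Measure (X × E D) :=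
  (jointLaw p ρ₀).map (Prod.map id Subtype.val)

/-- The law of the pair (conditioning variable, target) in the backward loss. -/
noncomputable def backwardLaw (p : X → X → ℝ≥0) (ρ₀ : X → ℝ≥0) : Measure (X × E D) :=
  (reversedLaw p ρ₀).map (Prod.map id Subtype.val)

section Loss

variable [IsFiniteMeasure (jointLaw p ρ₀)]

instance isFiniteMeasure_forwardLaw : IsFiniteMeasure (forwardLaw p ρ₀) :=
  Measure.isFiniteMeasure_map _ _

instance isFiniteMeasure_backwardLaw : IsFiniteMeasure (backwardLaw p ρ₀) :=
  Measure.isFiniteMeasure_map _ _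

lemma loss₀_eq_flowLoss {v : ℝ × E D × X → E D} (hv : Measurable v) :
    loss₀ p ρ₀ v = flowLoss (forwardLaw p ρ₀) v := by
  rw [forwardLaw, flowLoss_map_eq_lintegral (by fun_prop) hv]
  rfl

lemma loss₁_eq_flowLoss {v : ℝ × E D × X → E D} (hv : Measurable v) :
    loss₁ p ρ₀ v = flowLoss (backwardLaw p ρ₀) v := by
  rw [backwardLaw, reversedLaw, Measure.map_map (by fun_prop) measurable_swap,
    flowLoss_map_eq_lintegral (by fun_prop) hv]
  rfl

lemma fullLoss_eq_flowLoss_add {v₀ v₁ : ℝ × E D × X → E D} (hv₀ : Measurable v₀)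
    (hv₁ : Measurable v₁) :
    fullLoss p ρ₀ v₀ v₁ = flowLoss (forwardLaw p ρ₀) v₀ + flowLoss (backwardLaw p ρ₀) v₁ := by
  rw [fullLoss, loss₀_eq_flowLoss hv₀, loss₁_eq_flowLoss hv₁]

lemma measurable_bottleneck (hr : Measurable r) {v : ℝ × E D × E d → E D} (hv : Measurable v) :
    Measurable (bottleneck r v) :=
  hv.comp (f := fun a : ℝ × E D × X => (a.1, a.2.1, r a.2.2)) (by fun_prop)

lemma fmrcLoss_eq_flowLoss_add (hr : Measurable r) {v₀ v₁ : ℝ × E D × E d → E D}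
    (hv₀ : Measurable v₀) (hv₁ : Measurable v₁) :
    fmrcLoss p ρ₀ r v₀ v₁ = flowLoss ((forwardLaw p ρ₀).map (Prod.map r id)) v₀
      + flowLoss ((backwardLaw p ρ₀).map (Prod.map r id)) v₁ := by
  rw [flowLoss_map hr hv₀, flowLoss_map hr hv₁]
  exact fullLoss_eq_flowLoss_add (measurable_bottleneck hr hv₀) (measurable_bottleneck hr hv₁)

theorem isLeast_fullLossValues :
    IsLeast (fullLossValues p ρ₀)
      (minFlowLoss (forwardLaw p ρ₀) + minFlowLoss (backwardLaw p ρ₀)) := by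
  obtain ⟨⟨v₀, hv₀, h₀⟩, hmin₀⟩ := isLeast_minFlowLoss (forwardLaw p ρ₀)
  obtain ⟨⟨v₁, hv₁, h₁⟩, hmin₁⟩ := isLeast_minFlowLoss (backwardLaw p ρ₀)
  refine ⟨⟨v₀, v₁, hv₀, hv₁, by rw [fullLoss_eq_flowLoss_add hv₀ hv₁, h₀, h₁]⟩, ?_⟩
  rintro _ ⟨w₀, w₁, hw₀, hw₁, rfl⟩
  rw [fullLoss_eq_flowLoss_add hw₀ hw₁]
  exact add_le_add (hmin₀ ⟨w₀, hw₀, rfl⟩) (hmin₁ ⟨w₁, hw₁, rfl⟩)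

theorem isLeast_fmrcLossValues (hr : Measurable r) :
    IsLeast (fmrcLossValues p ρ₀ r)
      (minFlowLoss ((forwardLaw p ρ₀).map (Prod.map r id))
        + minFlowLoss ((backwardLaw p ρ₀).map (Prod.map r id))) := by
  obtain ⟨⟨v₀, hv₀, h₀⟩, hmin₀⟩ := isLeast_minFlowLoss ((forwardLaw p ρ₀).map (Prod.map r id))
  obtain ⟨⟨v₁, hv₁, h₁⟩, hmin₁⟩ := isLeast_minFlowLoss ((backwardLaw p ρ₀).map (Prod.map r id))
  refine ⟨⟨v₀, v₁, hv₀, hv₁, by rw [fmrcLoss_eq_flowLoss_add hr hv₀ hv₁, h₀, h₁]⟩, ?_⟩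
  rintro _ ⟨w₀, w₁, hw₀, hw₁, rfl⟩
  rw [fmrcLoss_eq_flowLoss_add hr hw₀ hw₁]
  exact add_le_add (hmin₀ ⟨w₀, hw₀, rfl⟩) (hmin₁ ⟨w₁, hw₁, rfl⟩)

end Loss

end TransitionDensity

end FMRC

theorem mainTheorem1 {D d : ℕ} (X : Set (EuclideanSpace ℝ (Fin D))) (hX : MeasurableSet X)
    (p : X → X → ℝ≥0) (hp : FMRC.IsTransitionDensity p)
    (ρ₀ : X → ℝ≥0) (hρ₀ : FMRC.IsProbDensity ρ₀)
    (r : X → EuclideanSpace ℝ (Fin d)) (hr : Measurable r) :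
    ∃ m mRC : ℝ≥0∞,
      IsLeast (FMRC.fullLossValues p ρ₀) m ∧
      IsLeast (FMRC.fmrcLossValues p ρ₀ r) mRC ∧
      m ≤ mRC ∧
      (m < ∞ → (mRC = m ↔ FMRC.Lumpable p ρ₀ r ∧ FMRC.Decomposable p ρ₀ r)) := by
  have := FMRC.sigmaFinite_leb hX
  have := FMRC.isProbabilityMeasure_jointLaw hp hρ₀
  have hle₀ := FMRC.minFlowLoss_le_minFlowLoss_map (FMRC.forwardLaw p ρ₀) hr
  have hle₁ := FMRC.minFlowLoss_le_minFlowLoss_map (FMRC.backwardLaw p ρ₀) hr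
  refine ⟨_, _, FMRC.isLeast_fullLossValues, FMRC.isLeast_fmrcLossValues hr,
    add_le_add hle₀ hle₁, fun hfin => ?_⟩
  obtain ⟨hfin₀, hfin₁⟩ := ENNReal.add_lt_top.1 hfin
  have hval := MeasurableEmbedding.subtype_coe hX
  rw [FMRC.add_eq_add_iff_of_le hle₀ hle₁ hfin₀ hfin₁, FMRC.minFlowLoss_map_eq_iff hr hfin₀,
    FMRC.minFlowLoss_map_eq_iff hr hfin₁, FMRC.forwardLaw, FMRC.backwardLaw,
    FMRC.condLawFactorsThrough_map_iff hval, FMRC.condLawFactorsThrough_map_iff hval,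
    FMRC.lumpable_iff_condLawFactorsThrough hp hρ₀ hr,
    FMRC.decomposable_iff_condLawFactorsThrough hp hρ₀ hr]
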